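/- Define integer sequences $(q_n)_{n\ge-2}$ and $(p_n)_{n\ge-2}$ by $q_{-2}=q_{-1}=1$, $q_n=2q_{n-1}+q_{n-2}$ for $n\ge0$, and $p_{-2}=p_{-1}=0$, $p_n=2p_{n-1}+p_{n-2}+\frac{q_{n-1}+q_{n-2}}{2}$ for $n\ge0$. For $n\ge0$, an integer $q\ge1$ and a real $B>0$ put $$\delta_n=\frac{p_n}{q_n\log q_n},\qquad \psi_n(q,B)=\sqrt B\left(q_n+\frac1{q_n^2}\right)\left(\delta_n\log q+(\sqrt2-1)\frac{2p_n}{q_n-1}\right).$$ Let $n\ge0$ and $q\ge q_n^6$ be integers and let $\chi$ be a nonprincipal Dirichlet character modulo $q$. Then for every integer $a$ and every integer $N\ge0$, $$\left|\sum_{m=a+1}^{a+N}\chi(m)\right|\le\delta_n\sqrt q\,\log q+\left(\sqrt{q_n+\frac1{q_n^2}}+(\sqrt2-1)\frac{2p_n}{q_n-1}+\frac12\right)\sqrt q+\psi_n(q,1).$$ -/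

import Mathlib

namespace PolyaVinogradov

/-- The integer sequence `q_{-2}, q_{-1}, q_0, …` with the index shifted by two:
`qShift k` is `q_{k-2}`, where `q_{-2} = q_{-1} = 1` and `q_n = 2 q_{n-1} + q_{n-2}` for `n ≥ 0`. -/
def qShift : ℕ → ℕ
  | 0 => 1
  | 1 => 1
  | k + 2 => 2 * qShift (k + 1) + qShift k

/-- The integer sequence `p_{-2}, p_{-1}, p_0, …` with the index shifted by two:
`pShift k` is `p_{k-2}`, where `p_{-2} = p_{-1} = 0` and
`p_n = 2 p_{n-1} + p_{n-2} + (q_{n-1} + q_{n-2}) / 2` for `n ≥ 0`.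
The division is exact, see `two_mul_pShift`. -/
def pShift : ℕ → ℕ
  | 0 => 0
  | 1 => 0
  | k + 2 => 2 * pShift (k + 1) + pShift k + (qShift (k + 1) + qShift k) / 2

/-- All terms `q_n`, `n ≥ -2`, are odd. -/
theorem qShift_odd : ∀ k : ℕ, Odd (qShift k)
  | 0 => by decide
  | 1 => by decide
  | k + 2 => by
    have h := qShift_odd k
    rw [qShift]
    exact (even_two_mul _).add_odd h

/-- The halving in the recursion for `p_n` is exact. -/
theorem two_mul_pShift (k : ℕ) :
    2 * pShift (k + 2)
      = 2 * (2 * pShift (k + 1) + pShift k) + (qShift (k + 1) + qShift k) := by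
  have h : 2 ∣ qShift (k + 1) + qShift k :=
    ((qShift_odd (k + 1)).add_odd (qShift_odd k)).two_dvd
  rw [pShift]
  omega

/-- `q_n` for `n ≥ 0`: `3, 7, 17, 41, 99, …`. -/
def qSeq (n : ℕ) : ℕ := qShift (n + 2)

/-- `p_n` for `n ≥ 0`: `1, 4, 14, 44, 131, …`. -/
def pSeq (n : ℕ) : ℕ := pShift (n + 2)

/-- `δ_n = p_n / (q_n log q_n)`. -/
noncomputable def delta (n : ℕ) : ℝ :=
  (pSeq n : ℝ) / ((qSeq n : ℝ) * Real.log (qSeq n : ℝ))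

/-- `ψ_n(q, B) = √B (q_n + q_n⁻²) (δ_n log q + (√2 - 1) · 2 p_n / (q_n - 1))`. -/
noncomputable def psi (n q : ℕ) (B : ℝ) : ℝ :=
  √B * ((qSeq n : ℝ) + 1 / (qSeq n : ℝ) ^ 2) *
    (delta n * Real.log (q : ℝ) + (√2 - 1) * (2 * (pSeq n : ℝ) / ((qSeq n : ℝ) - 1)))

end PolyaVinogradov

/-!
The bound follows from a Pólya–Vinogradov inequality with constants that do not depend on `n`:
for `q ≥ 729`, every sum of a nonprincipal character modulo `q` over an interval is at most
`0.28 √q log q + 2.52 √q` (`norm_sum_le`). This is enough since `δ_n ≥ 0.28` (`delta_ge`), the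
coefficient of `√q` is at least `2.52` (`constant_ge`), and `ψ_n(q, 1) ≥ 0`.

The only arithmetic input is a mean square bound, `meanSquareBound_dirichletCharacter`: the sums of
`χ` over the intervals of length `H` have mean square at most `H`. For a primitive character this is
Parseval's identity and `|τ(χ)|² = q`. A general character is a primitive one restricted to the
integers coprime to `q`, and removing the multiples of one prime at a time preserves the bound
(`MeanSquareBound.sieve`).

To bound a sum over an interval of length `N ≤ q / 2`, replace `χ` by its average over a window of
length `H`, and let `H` grow from about `√q` to about `N` by factors of five. The first
smoothing changes the sum by at most `H / 2`. Passing from `H` to `5 H` changes it by a combination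
of values near the two endpoints only, and the Cauchy-Schwarz inequality with the mean square bound
shows that this is at most `(2 / √5) √q` (`norm_smoothedSum_five_sub_le`). At the last scale the same
two tools bound the whole smoothed sum by `2 √q`. There are at most `log q / (2 log 5)` steps, and
`1 / (√5 log 5) < 0.28`.
-/

open Finset

namespace PolyaVinogradov

/-! ### Primitive characters: Fourier analysis modulo `d` -/

/-- Parseval's identity for the discrete Fourier transform. -/
theorem sum_norm_sq_dft {d : ℕ} [NeZero d] (Φ : ZMod d → ℂ) :
    ∑ k, ‖ZMod.dft Φ k‖ ^ 2 = d * ∑ j, ‖Φ j‖ ^ 2 := by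
  have key : ∑ k, (starRingEnd ℂ) (ZMod.dft Φ k) * ZMod.dft Φ k
      = d * ∑ j, (starRingEnd ℂ) (Φ j) * Φ j := by
    have h (k : ZMod d) : (starRingEnd ℂ) (ZMod.dft Φ k)
        = ∑ j, ZMod.stdAddChar (j * k) * (starRingEnd ℂ) (Φ j) := by
      rw [ZMod.dft_apply, map_sum]
      refine sum_congr rfl fun j _ ↦ ?_
      rw [smul_eq_mul, map_mul, AddChar.map_neg_eq_conj, Complex.conj_conj]
    have inv (j : ZMod d) : ∑ k, ZMod.stdAddChar (j * k) * ZMod.dft Φ k = d * Φ j := by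
      have := congrFun (ZMod.dft_dft Φ) (-j)
      rw [ZMod.dft_apply] at this
      simpa [mul_comm] using this
    simp_rw [h, sum_mul]
    rw [sum_comm, mul_sum]
    refine sum_congr rfl fun j _ ↦ ?_
    rw [mul_left_comm, ← inv, mul_sum]
    exact sum_congr rfl fun k _ ↦ by ring
  have hc (z : ℂ) : ((‖z‖ ^ 2 : ℝ) : ℂ) = (starRingEnd ℂ) z * z := by
    rw [mul_comm, Complex.mul_conj, Complex.normSq_eq_norm_sq]
  have : ((∑ k, ‖ZMod.dft Φ k‖ ^ 2 : ℝ) : ℂ) = ((d * ∑ j, ‖Φ j‖ ^ 2 : ℝ) : ℂ) := by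
    rw [Complex.ofReal_sum, Complex.ofReal_mul, Complex.ofReal_sum]
    simp_rw [hc]
    exact_mod_cast key
  exact_mod_cast this

/-- A primitive character has `|τ(χ)|² = d`: its Fourier transform is `τ(χ)` times a function with the
same absolute values as `χ` up to reflection, so this is Parseval's identity for `χ`. -/
theorem norm_sq_gaussSum {d : ℕ} [NeZero d] {χ : DirichletCharacter ℂ d} (hχ : χ.IsPrimitive) :
    ‖gaussSum χ ZMod.stdAddChar‖ ^ 2 = d := by
  have h := sum_norm_sq_dft (χ : ZMod d → ℂ)
  have hk (k : ZMod d) : ‖ZMod.dft (χ : ZMod d → ℂ) k‖ ^ 2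
      = ‖χ k‖ ^ 2 * ‖gaussSum χ ZMod.stdAddChar‖ ^ 2 := by
    rw [hχ.fourierTransform_eq_inv_mul_gaussSum, norm_mul, mul_pow, ← MulChar.star_eq_inv,
      MulChar.star_apply, norm_star, ← neg_one_mul k, map_mul, norm_mul]
    have : ‖χ (-1)‖ = 1 := by
      have := χ.unit_norm_eq_one (-1)
      simpa using this
    rw [this, one_mul]
  simp_rw [hk] at h
  rw [← sum_mul, mul_comm] at h
  refine mul_right_cancel₀ (ne_of_gt ?_) h
  have : ‖χ 1‖ ^ 2 ≤ ∑ k, ‖χ k‖ ^ 2 :=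
    single_le_sum (f := fun k ↦ ‖χ k‖ ^ 2) (fun _ _ ↦ by positivity) (mem_univ 1)
  refine lt_of_lt_of_le ?_ this
  simp

/-- Mean square of a primitive character over the translates of a fixed set `A`. Summation over the
translates multiplies Fourier transforms; that of `χ` is bounded by `√d`, and Parseval's identity
applied to the indicator function of `A` evaluates what remains. -/
theorem sum_norm_sq_translates_le {d : ℕ} [NeZero d] {χ : DirichletCharacter ℂ d}
    (hχ : χ.IsPrimitive) (A : Finset (ZMod d)) :
    ∑ x, ‖∑ a ∈ A, χ (x + a)‖ ^ 2 ≤ d * #A := by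
  have hd : (0 : ℝ) < d := by exact_mod_cast NeZero.pos d
  set W : ZMod d → ℂ := fun x ↦ ∑ a ∈ A, χ (x + a) with hW
  set w : ZMod d → ℂ := fun a ↦ if a ∈ A then 1 else 0 with hw
  have hdft (k : ZMod d) : ZMod.dft W k = ZMod.dft w (-k) * ZMod.dft (χ : ZMod d → ℂ) k := by
    simp only [ZMod.dft_apply, hW, hw, smul_eq_mul, mul_sum, mul_ite, mul_one, mul_zero,
      sum_ite_mem, univ_inter, mul_neg, neg_neg]
    rw [← mul_sum, sum_comm, sum_mul]
    refine sum_congr rfl fun a _ ↦ ?_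
    rw [mul_sum]
    refine Fintype.sum_equiv (Equiv.addRight a) _ _ fun x ↦ ?_
    rw [Equiv.coe_addRight, ← mul_assoc, ← AddChar.map_add_eq_mul]
    congr 2
    ring
  have hle (k : ZMod d) : ‖ZMod.dft W k‖ ^ 2 ≤ ‖ZMod.dft w (-k)‖ ^ 2 * d := by
    rw [hdft, norm_mul, mul_pow]
    gcongr
    rw [hχ.fourierTransform_eq_inv_mul_gaussSum, norm_mul, mul_pow, norm_sq_gaussSum hχ]
    have := DirichletCharacter.norm_le_one χ⁻¹ (-k)
    have := pow_le_one₀ (n := 2) (norm_nonneg _) this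
    nlinarith
  have h1 := sum_norm_sq_dft W
  have h2 := sum_norm_sq_dft w
  have h3 : ∑ k, ‖ZMod.dft w (-k)‖ ^ 2 = ∑ k, ‖ZMod.dft w k‖ ^ 2 :=
    Fintype.sum_equiv (Equiv.neg _) _ _ fun _ ↦ rfl
  have h4 : ∑ j, ‖w j‖ ^ 2 = #A := by
    have : ∀ j, ‖w j‖ ^ 2 = if j ∈ A then (1 : ℝ) else 0 := fun j ↦ by
      simp only [hw]; split_ifs <;> simp
    simp_rw [this]
    simp
  have h5 : ∑ k, ‖ZMod.dft W k‖ ^ 2 ≤ d * (d * #A) := by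
    calc _ ≤ ∑ k, ‖ZMod.dft w (-k)‖ ^ 2 * d := sum_le_sum fun k _ ↦ hle k
      _ = _ := by rw [← sum_mul, h3, h2, h4]; ring
  rw [h1] at h5
  exact le_of_mul_le_mul_left h5 hd

/-! ### Periodic functions on the integers -/

/-- The sum of a periodic function over a period does not depend on where the period starts. -/
theorem sum_Ico_period {E : Type*} [AddCommGroup E] {g : ℤ → E} {k : ℕ}
    (hg : Function.Periodic g (k : ℤ)) (a : ℤ) :
    ∑ x ∈ Ico a (a + k), g x = ∑ x ∈ Ico (0 : ℤ) k, g x := by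
  have step (b : ℤ) : ∑ x ∈ Ico (b + 1) (b + 1 + k), g x = ∑ x ∈ Ico b (b + k), g x := by
    rcases Nat.eq_zero_or_pos k with rfl | hk
    · simp
    have h1 : Ico b (b + k) = insert b (Ico (b + 1) (b + k)) := by
      ext x; simp only [mem_Ico, mem_insert]; omega
    have h2 : Ico (b + 1) (b + 1 + k) = insert (b + k) (Ico (b + 1) (b + k)) := by
      ext x; simp only [mem_Ico, mem_insert]; omega
    rw [h1, h2, sum_insert (by simp), sum_insert (by simp), hg b]
  induction a using Int.induction_on with
  | zero => simp
  | succ i ih => rw [step, ih]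
  | pred i ih => rw [← ih, ← step]; simp

theorem sum_Ico_zmod {d : ℕ} [NeZero d] {E : Type*} [AddCommGroup E] (g : ZMod d → E) :
    ∑ x ∈ Ico (0 : ℤ) d, g x = ∑ x, g x := by
  have hd : (0 : ℤ) < d := by exact_mod_cast NeZero.pos d
  refine sum_bij' (fun x _ ↦ (x : ZMod d)) (fun x _ ↦ (x.val : ℤ)) (by simp) ?_ ?_ ?_ ?_
  · intro x _
    have := x.val_lt
    simp only [mem_Ico]; omega
  · intro x hx
    rw [mem_Ico] at hx
    rw [ZMod.val_intCast, Int.emod_eq_of_lt hx.1 hx.2]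
  · intro x _; simp
  · intro x _; rfl

theorem sum_Ico_add_sum_Ico {E : Type*} [AddCommGroup E] (f : ℤ → E) {a b c : ℤ} (hab : a ≤ b)
    (hbc : b ≤ c) : ∑ x ∈ Ico a b, f x + ∑ x ∈ Ico b c, f x = ∑ x ∈ Ico a c, f x := by
  rw [← Ico_union_Ico_eq_Ico hab hbc, sum_union (Ico_disjoint_Ico_consecutive a b c)]

/-- If `f` sums to zero over a period `k`, an interval may be shortened by multiples of `k`. -/
theorem sum_Ico_add_of_sum_period_eq_zero {E : Type*} [AddCommGroup E] {f : ℤ → E} {k : ℕ}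
    (hf : Function.Periodic f (k : ℤ)) (h0 : ∑ x ∈ Ico (0 : ℤ) k, f x = 0) (a : ℤ) (H : ℕ) :
    ∑ x ∈ Ico a (a + H), f x = ∑ x ∈ Ico a (a + (H % k : ℕ)), f x := by
  have h (j r : ℕ) : ∑ x ∈ Ico a (a + (r + k * j : ℕ)), f x = ∑ x ∈ Ico a (a + r), f x := by
    induction j with
    | zero => simp
    | succ j ih =>
      rw [← ih, ← sum_Ico_add_sum_Ico f (a := a) (b := a + (r + k * j : ℕ))
        (by omega) (by push_cast; nlinarith)]
      have := sum_Ico_period hf (a + (r + k * j : ℕ))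
      rw [h0] at this
      have e : a + ((r + k * (j + 1) : ℕ) : ℤ) = a + (r + k * j : ℕ) + k := by push_cast; ring
      rw [e, this, add_zero]
  conv_lhs => rw [← Nat.mod_add_div H k]
  exact h _ _

/-! ### Mean squares over short intervals -/

/-- The mean, over a period `k`, of the squared sums of `f` along the intervals of length `H` is at
most `H`, for every `H`. Intended for `f` with period `k`, when it does not matter which period is
taken. -/
def MeanSquareBound (f : ℤ → ℂ) (k : ℕ) : Prop :=
  ∀ H : ℕ, ∑ x ∈ Ico (0 : ℤ) k, ‖∑ y ∈ Ico x (x + H), f y‖ ^ 2 ≤ (k * H : ℝ)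

theorem periodic_dirichlet {d : ℕ} (χ : DirichletCharacter ℂ d) :
    Function.Periodic (fun y : ℤ ↦ χ (y : ZMod d)) (d : ℤ) := fun y ↦ by simp

theorem sum_dirichlet_period {d : ℕ} [NeZero d] {χ : DirichletCharacter ℂ d} (h1 : χ ≠ 1) :
    ∑ y ∈ Ico (0 : ℤ) d, χ (y : ZMod d) = 0 := by
  rw [sum_Ico_zmod (fun x ↦ χ x)]
  exact MulChar.sum_eq_zero_of_ne_one h1

theorem meanSquareBound_of_isPrimitive {d : ℕ} [NeZero d] {χ : DirichletCharacter ℂ d}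
    (hχ : χ.IsPrimitive) (h1 : χ ≠ 1) : MeanSquareBound (fun y : ℤ ↦ χ (y : ZMod d)) d := by
  intro H
  have hlt := Nat.mod_lt H (NeZero.pos d)
  set A : Finset (ZMod d) := (range (H % d)).image (fun h : ℕ ↦ (h : ZMod d)) with hA
  have hinj : Set.InjOn (fun h : ℕ ↦ (h : ZMod d)) (range (H % d)) := by
    intro x hx y hy hxy
    simp only [coe_range, Set.mem_Iio] at hx hy
    have := congrArg ZMod.val hxy
    simpa [ZMod.val_natCast, Nat.mod_eq_of_lt (hx.trans hlt), Nat.mod_eq_of_lt (hy.trans hlt)]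
      using this
  have hsum (x : ℤ) : ∑ y ∈ Ico x (x + H), χ (y : ZMod d) = ∑ a ∈ A, χ ((x : ZMod d) + a) := by
    rw [sum_Ico_add_of_sum_period_eq_zero (periodic_dirichlet χ) (sum_dirichlet_period h1), hA,
      sum_image hinj]
    symm
    refine sum_bij (fun h _ ↦ x + (h : ℤ)) ?_ ?_ ?_ ?_
    · intro h hh; simp only [mem_range, mem_Ico] at hh ⊢; omega
    · intro a _ b _ hab; omega
    · intro y hy
      simp only [mem_Ico] at hy
      exact ⟨(y - x).toNat, by simp only [mem_range]; omega, by omega⟩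
    · intro h _; simp
  simp_rw [hsum]
  rw [sum_Ico_zmod (fun x : ZMod d ↦ ‖∑ a ∈ A, χ (x + a)‖ ^ 2)]
  refine (sum_norm_sq_translates_le hχ A).trans ?_
  have : #A ≤ H := card_image_le.trans (by rw [card_range]; exact Nat.mod_le _ _)
  gcongr

theorem sum_Ico_eq_sum_range_int {E : Type*} [AddCommMonoid E] (g : ℤ → E) (a : ℤ) (n : ℕ) :
    ∑ y ∈ Ico a (a + n), g y = ∑ r ∈ range n, g (a + r) := by
  symm
  refine sum_bij (fun r _ ↦ a + (r : ℤ)) ?_ ?_ ?_ ?_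
  · intro r hr; simp only [mem_range, mem_Ico] at hr ⊢; omega
  · intro r _ s _ h; omega
  · intro y hy
    simp only [mem_Ico] at hy
    exact ⟨(y - a).toNat, by simp only [mem_range]; omega, by omega⟩
  · intro r _; rfl

theorem sum_Ico_shift {E : Type*} [AddCommMonoid E] (g : ℤ → E) (a c : ℤ) (n : ℕ) :
    ∑ y ∈ Ico a (a + n), g (y + c) = ∑ y ∈ Ico (a + c) (a + c + n), g y := by
  rw [sum_Ico_eq_sum_range_int, sum_Ico_eq_sum_range_int]
  exact sum_congr rfl fun r _ ↦ by ring_nf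

theorem sum_Ico_mul_eq_sum_blocks {E : Type*} [AddCommGroup E] (g : ℤ → E) (k p : ℕ) :
    ∑ x ∈ Ico (0 : ℤ) (k * p : ℕ), g x = ∑ j ∈ range p, ∑ x ∈ Ico (0 : ℤ) k, g (x + k * j) := by
  induction p with
  | zero => simp
  | succ p ih =>
    rw [sum_range_succ, ← ih,
      ← sum_Ico_add_sum_Ico g (a := 0) (b := (k * p : ℕ)) (by positivity) (by gcongr; simp)]
    congr 1
    have := sum_Ico_shift g 0 (k * p) k
    rw [zero_add, zero_add] at this
    rw [this]
    push_cast
    rw [mul_add, mul_one]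

theorem sum_Ico_mul_eq_sum_residues {E : Type*} [AddCommGroup E] (g : ℤ → E) (k p : ℕ) :
    ∑ x ∈ Ico (0 : ℤ) (k * p : ℕ), g x = ∑ r ∈ range p, ∑ x ∈ Ico (0 : ℤ) k, g (p * x + r) := by
  induction k with
  | zero => simp
  | succ k ih =>
    rw [← sum_Ico_add_sum_Ico g (a := 0) (b := (k * p : ℕ)) (by positivity) (by gcongr; simp), ih]
    have h (r : ℕ) : ∑ x ∈ Ico (0 : ℤ) (k + 1 : ℕ), g (p * x + r)
        = ∑ x ∈ Ico (0 : ℤ) k, g (p * x + r) + g (p * k + r) := by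
      rw [← sum_Ico_add_sum_Ico _ (a := 0) (b := (k : ℕ)) (by positivity) (by simp)]
      congr 1
      have : Ico (k : ℤ) ((k + 1 : ℕ) : ℤ) = {(k : ℤ)} := by
        ext x; simp only [mem_Ico, mem_singleton]; omega
      rw [this, sum_singleton]
    simp_rw [h]
    rw [sum_add_distrib]
    congr 1
    have := sum_Ico_eq_sum_range_int g (p * k) p
    rw [← this]
    push_cast
    congr 2 <;> ring

/-- Hermite's identity for `n / p`. -/
theorem sum_range_add_div {p : ℕ} (hp : 0 < p) (n : ℕ) : ∑ r ∈ range p, (n + r) / p = n := by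
  induction n with
  | zero =>
    refine sum_eq_zero fun r hr ↦ ?_
    rw [zero_add, Nat.div_eq_of_lt (mem_range.1 hr)]
  | succ n ih =>
    have h1 := sum_range_succ (fun r ↦ (n + r) / p) p
    have h2 := sum_range_succ' (fun r ↦ (n + r) / p) p
    rw [h1, ih, Nat.add_div_right _ hp, add_zero] at h2
    have : ∑ r ∈ range p, (n + 1 + r) / p = ∑ r ∈ range p, (n + (r + 1)) / p :=
      sum_congr rfl fun r _ ↦ by congr 1; ring
    omega

/-- As `p` and `k` are coprime, exactly one of the `p` shifts `y + k j` is divisible by `p`. -/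
theorem sum_ite_dvd_add_mul {E : Type*} [AddCommMonoid E] {k p : ℕ} (hp : 0 < p)
    (hcop : p.Coprime k) (y : ℤ) (c : E) :
    ∑ j ∈ range p, (if (p : ℤ) ∣ y + k * j then c else 0) = c := by
  obtain ⟨u, v, huv⟩ := (Nat.isCoprime_iff_coprime.2 hcop : IsCoprime (p : ℤ) k)
  have hp' : (0 : ℤ) < p := by exact_mod_cast hp
  have hnn := Int.emod_nonneg (-y * v) hp'.ne'
  have hlt := Int.emod_lt_of_pos (-y * v) hp'
  have hdm := Int.emod_add_mul_ediv (-y * v) p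
  set j₀ := (-y * v) % p with hj₀
  have hdvd : (p : ℤ) ∣ y + k * j₀ :=
    ⟨y * u - k * ((-y * v) / p), by linear_combination k * hdm - y * huv⟩
  rw [sum_eq_single j₀.toNat]
  · rw [Int.toNat_of_nonneg hnn, if_pos hdvd]
  · intro j hj hne
    rw [if_neg]
    intro h
    have h1 : (p : ℤ) ∣ k * (j - j₀) := by
      have := dvd_sub h hdvd
      rwa [show y + k * (j : ℤ) - (y + k * j₀) = k * (j - j₀) by ring] at this
    have h2 : (p : ℤ) ∣ j - j₀ := (Nat.isCoprime_iff_coprime.2 hcop).dvd_of_dvd_mul_left h1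
    have hj' := mem_range.1 hj
    have := Int.eq_zero_of_abs_lt_dvd h2 (by rw [abs_lt]; constructor <;> omega)
    omega
  · intro h
    exact absurd (mem_range.2 (by omega)) h

/-- The multiples `y = p z` in an interval of length `H` that starts at `p x + r`: their quotients `z`
fill an interval, whose ends are written with `⌈n / p⌉ = ⌊(p - 1 + n) / p⌋`. -/
theorem sum_multiples {f : ℤ → ℂ} {p : ℕ} (hp : 0 < p) (hmul : ∀ y, f (p * y) = f p * f y)
    (x : ℤ) (r H : ℕ) :
    ∑ y ∈ Ico (p * x + r) (p * x + r + H), (if (p : ℤ) ∣ y then f y else 0)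
      = f p * ∑ z ∈ Ico (x + ((p - 1 + r) / p : ℕ))
        (x + ((p - 1 + r) / p : ℕ) + ((H + (p - 1) + r) / p - (p - 1 + r) / p : ℕ)), f z := by
  have hp' : (0 : ℤ) < p := by exact_mod_cast hp
  have hle : (p - 1 + r) / p ≤ (H + (p - 1) + r) / p := Nat.div_le_div_right (by omega)
  have ceil_iff (n : ℕ) (t : ℤ) : (((p - 1 + n) / p : ℕ) : ℤ) ≤ t ↔ (n : ℤ) ≤ p * t := by
    rw [← Int.lt_add_one_iff, Int.natCast_ediv, Int.ediv_lt_iff_lt_mul hp']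
    push_cast [Nat.cast_sub (show 1 ≤ p from hp)]
    constructor <;> intro h <;> nlinarith
  rw [← sum_filter, mul_sum]
  symm
  refine sum_bij (fun z _ ↦ p * z) ?_ ?_ ?_ ?_
  · intro z hz
    rw [mem_Ico] at hz
    have h1 := (ceil_iff r (z - x)).1 (by omega)
    have h2 := mt (ceil_iff (H + r) (z - x)).2 (by
      rw [show p - 1 + (H + r) = H + (p - 1) + r by ring]; omega)
    rw [mem_filter, mem_Ico]
    refine ⟨⟨by linarith, ?_⟩, dvd_mul_right _ _⟩
    push_cast at h2
    linarith
  · intro a _ b _ h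
    exact mul_left_cancel₀ hp'.ne' h
  · intro y hy
    rw [mem_filter, mem_Ico] at hy
    obtain ⟨⟨h1, h2⟩, z, rfl⟩ := hy
    refine ⟨z, ?_, rfl⟩
    have h3 := (ceil_iff r (z - x)).2 (by linarith)
    have h4 := mt (ceil_iff (H + r) (z - x)).1 (by push_cast; linarith)
    rw [show p - 1 + (H + r) = H + (p - 1) + r by ring] at h4
    rw [mem_Ico]
    omega
  · intro z _; exact (hmul z).symm

/-- The period over which the mean is taken may start anywhere. -/
theorem MeanSquareBound.sum_shift_le {f : ℤ → ℂ} {k : ℕ} (hf : Function.Periodic f (k : ℤ))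
    (h : MeanSquareBound f k) (a : ℤ) (H : ℕ) :
    ∑ x ∈ Ico a (a + k), ‖∑ y ∈ Ico x (x + H), f y‖ ^ 2 ≤ (k * H : ℝ) := by
  rw [sum_Ico_period]
  · exact h H
  · intro x
    have := sum_Ico_shift f x k H
    simp only [hf _] at this
    simp only [this]

/-- Removing from `f` the multiples of a `p` coprime to the period preserves the mean square bound.
With `W` and `M` the sums of `f` over all terms and over the multiples of `p` in an interval, the
new sums are `W - M`. Averaging `M` over the shifts by multiples of `k` gives `W / p`, so the cross
term is explicit; the mean square of `M` is bounded by the hypothesis, because `f (p z) = f p * f z`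
turns `M` into a sum of `f` over an interval about `p` times shorter. -/
theorem MeanSquareBound.sieve {f : ℤ → ℂ} {k p : ℕ} (hp : 2 ≤ p) (hcop : p.Coprime k)
    (hf : Function.Periodic f (k : ℤ)) (hmul : ∀ y, f (p * y) = f p * f y) (hfp : ‖f p‖ ≤ 1)
    (h : MeanSquareBound f k) :
    MeanSquareBound (fun y ↦ if (p : ℤ) ∣ y then 0 else f y) (k * p) := by
  intro H
  have hp0 : 0 < p := by omega
  set W : ℤ → ℂ := fun x ↦ ∑ y ∈ Ico x (x + H), f y with hW
  set M : ℤ → ℂ := fun x ↦ ∑ y ∈ Ico x (x + H), (if (p : ℤ) ∣ y then f y else 0) with hM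
  set V : ℝ := ∑ x ∈ Ico (0 : ℤ) k, ‖W x‖ ^ 2 with hV
  have hWper (x : ℤ) (j : ℕ) : W (x + k * j) = W x := by
    simp only [hW]
    rw [← sum_Ico_shift]
    exact sum_congr rfl fun y _ ↦ by rw [mul_comm]; exact hf.nat_mul j y
  have hMavg (x : ℤ) : ∑ j ∈ range p, M (x + k * j) = W x := by
    simp only [hM, hW]
    simp_rw [← sum_Ico_shift _ x]
    rw [sum_comm]
    refine sum_congr rfl fun y _ ↦ ?_
    rw [← sum_ite_dvd_add_mul hp0 hcop y (f y)]
    refine sum_congr rfl fun j _ ↦ ?_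
    rw [mul_comm (k : ℤ), hf.nat_mul j y]
  -- Expand `‖W - M‖²`; the sums of the three terms follow.
  have hG (x : ℤ) : ‖∑ y ∈ Ico x (x + H), (if (p : ℤ) ∣ y then 0 else f y)‖ ^ 2
      = ‖W x‖ ^ 2 - 2 * inner ℝ (W x) (M x) + ‖M x‖ ^ 2 := by
    rw [← norm_sub_sq_real, hW, hM]
    simp only
    rw [← sum_sub_distrib]
    congr 2
    exact sum_congr rfl fun y _ ↦ by split_ifs <;> simp
  have hWsum : ∑ x ∈ Ico (0 : ℤ) (k * p : ℕ), ‖W x‖ ^ 2 = p * V := by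
    rw [sum_Ico_mul_eq_sum_blocks]
    simp_rw [hWper]
    simp [hV]
  have hcross : ∑ x ∈ Ico (0 : ℤ) (k * p : ℕ), inner ℝ (W x) (M x) = V := by
    rw [sum_Ico_mul_eq_sum_blocks, sum_comm]
    refine sum_congr rfl fun x _ ↦ ?_
    simp_rw [hWper]
    rw [← inner_sum, hMavg, real_inner_self_eq_norm_sq]
  have hMsum : ∑ x ∈ Ico (0 : ℤ) (k * p : ℕ), ‖M x‖ ^ 2 ≤ k * H := by
    -- The lengths of the intervals of quotients add up to `H` over the residues modulo `p`.
    have hlen : ∑ r ∈ range p, ((H + (p - 1) + r) / p - (p - 1 + r) / p) = H := by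
      have h1 := sum_range_add_div hp0 (H + (p - 1))
      have h2 := sum_range_add_div hp0 (p - 1)
      have h3 := sum_tsub_distrib (range p) (f := fun r ↦ (H + (p - 1) + r) / p)
        (g := fun r ↦ (p - 1 + r) / p) fun r _ ↦ Nat.div_le_div_right (by omega)
      rw [h3, h1, h2]
      omega
    rw [sum_Ico_mul_eq_sum_residues]
    calc _ ≤ ∑ r ∈ range p, (k * ((H + (p - 1) + r) / p - (p - 1 + r) / p : ℕ) : ℝ) := by
          refine sum_le_sum fun r _ ↦ ?_
          have hs := h.sum_shift_le hf (0 + ((p - 1 + r) / p : ℕ))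
            ((H + (p - 1) + r) / p - (p - 1 + r) / p)
          rw [← sum_Ico_shift, zero_add] at hs
          refine le_trans (sum_le_sum fun x _ ↦ ?_) hs
          simp only [hM]
          rw [sum_multiples hp0 hmul, norm_mul, mul_pow]
          have := pow_le_one₀ (n := 2) (norm_nonneg _) hfp
          exact mul_le_of_le_one_left (by positivity) this
      _ = k * H := by
          rw [← mul_sum]
          exact_mod_cast congrArg (k * ·) hlen
  simp_rw [hG]
  rw [sum_add_distrib, sum_sub_distrib, ← mul_sum, hWsum, hcross]
  have hVle : V ≤ k * H := h H
  have hp2 : (2 : ℝ) ≤ p := by exact_mod_cast hp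
  have : (0 : ℝ) ≤ k * H := by positivity
  -- The coefficient `p - 2` of `V` is nonnegative, so the upper bound for `V` applies.
  have hfin (B : ℝ) (hB : B ≤ k * H) : p * V - 2 * V + B ≤ k * p * H := by
    nlinarith [mul_le_mul_of_nonneg_left hVle (sub_nonneg.2 hp2)]
  refine (hfin _ hMsum).trans_eq ?_
  push_cast
  ring

theorem MeanSquareBound.mul_period {f : ℤ → ℂ} {k : ℕ} (hf : Function.Periodic f (k : ℤ))
    (h : MeanSquareBound f k) (p : ℕ) : MeanSquareBound f (k * p) := by
  intro H
  rw [sum_Ico_mul_eq_sum_blocks]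
  refine (sum_le_sum fun j _ ↦ ?_).trans_eq (b := ∑ j ∈ range p, (k * H : ℝ)) ?_
  · have := h.sum_shift_le hf (0 + k * j) H
    rwa [← sum_Ico_shift, zero_add] at this
  · simp; ring

theorem MeanSquareBound.of_mul_period {f : ℤ → ℂ} {k p : ℕ} (hp : 0 < p)
    (hf : Function.Periodic f (k : ℤ))
    (h : MeanSquareBound f (k * p)) : MeanSquareBound f k := by
  intro H
  have := h H
  rw [sum_Ico_mul_eq_sum_blocks] at this
  have e (j : ℕ) : ∑ x ∈ Ico (0 : ℤ) k, ‖∑ y ∈ Ico (x + k * j) (x + k * j + H), f y‖ ^ 2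
      = ∑ x ∈ Ico (0 : ℤ) k, ‖∑ y ∈ Ico x (x + H), f y‖ ^ 2 := by
    refine sum_congr rfl fun x _ ↦ ?_
    rw [← sum_Ico_shift]
    congr 2
    exact sum_congr rfl fun y _ ↦ by rw [mul_comm]; exact hf.nat_mul j y
  simp_rw [e] at this
  rw [sum_const, card_range, nsmul_eq_mul] at this
  have hp' : (0 : ℝ) < p := by exact_mod_cast hp
  refine le_of_mul_le_mul_left ?_ hp'
  refine this.trans_eq ?_
  push_cast; ring

/-- The mean square bound for a primitive character restricted to the integers coprime to `r`, by
sieving out the primes of `r` one at a time. A prime that divides `d * a` has nothing left to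
remove: `χ`, or the coprimality condition, vanishes at its multiples already. -/
theorem meanSquareBound_coprime {d : ℕ} [NeZero d] {χ : DirichletCharacter ℂ d}
    (hχ : χ.IsPrimitive) (h1 : χ ≠ 1) (r : ℕ) (hr : r ≠ 0) :
    MeanSquareBound (fun y : ℤ ↦ if IsCoprime y (r : ℤ) then χ (y : ZMod d) else 0) (d * r) := by
  have hper (a : ℕ) : Function.Periodic
      (fun y : ℤ ↦ if IsCoprime y (a : ℤ) then χ (y : ZMod d) else 0) ((d * a : ℕ) : ℤ) := by
    intro y
    have : IsCoprime (y + ((d * a : ℕ) : ℤ)) (a : ℤ) ↔ IsCoprime y (a : ℤ) := by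
      push_cast; exact IsCoprime.add_mul_right_left_iff
    simp only [this]
    simp
  induction r using induction_on_primes with
  | zero => exact absurd rfl hr
  | one => simpa [isCoprime_one_right] using meanSquareBound_of_isPrimitive hχ h1
  | prime_mul p a hp ih =>
    have ha : a ≠ 0 := by rintro rfl; simp at hr
    have hpi : Prime (p : ℤ) := Nat.prime_iff_prime_int.1 hp
    have hsplit (y : ℤ) : IsCoprime y ((p * a : ℕ) : ℤ) ↔ ¬ (p : ℤ) ∣ y ∧ IsCoprime y (a : ℤ) := by
      push_cast
      rw [IsCoprime.mul_right_iff, isCoprime_comm, hpi.coprime_iff_not_dvd]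
    have e : d * (p * a) = d * a * p := by ring
    rw [e]
    by_cases hpk : p ∣ d * a
    · convert (ih ha).mul_period (hper a) p using 2 with y
      by_cases hy : (p : ℤ) ∣ y
      · rw [if_neg (by rw [hsplit]; tauto)]
        rcases hp.dvd_mul.1 hpk with hd | hda
        · have : χ (y : ZMod d) = 0 := by
            rw [DirichletCharacter.apply_eq_zero_iff]
            intro hc
            exact hpi.not_isUnit (hc.isUnit_of_dvd' hy (by exact_mod_cast hd))
          simp [this]
        · rw [if_neg]
          intro hc
          exact hpi.not_isUnit (hc.isUnit_of_dvd' hy (by exact_mod_cast hda))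
      · simp only [hsplit, hy, not_false_eq_true, true_and]
    · have hcop : p.Coprime (d * a) := hp.coprime_iff_not_dvd.2 hpk
      have hpa : IsCoprime (p : ℤ) (a : ℤ) :=
        Nat.isCoprime_iff_coprime.2 (Nat.Coprime.coprime_mul_left_right hcop)
      convert (ih ha).sieve hp.two_le hcop (hper a) ?_ ?_ using 2 with y
      · by_cases hy : (p : ℤ) ∣ y <;> simp only [hsplit, hy] <;> simp
      · intro y
        simp [IsCoprime.mul_left_iff, hpa]
      · split_ifs
        exact DirichletCharacter.norm_le_one χ _

/-- Every nonprincipal character modulo `q` satisfies the mean square bound: it is its primitive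
character restricted to the integers coprime to `q`. -/
theorem meanSquareBound_dirichletCharacter {q : ℕ} [NeZero q] {χ : DirichletCharacter ℂ q}
    (h1 : χ ≠ 1) : MeanSquareBound (fun y : ℤ ↦ χ (y : ZMod q)) q := by
  have : NeZero χ.conductor := ⟨χ.conductor_ne_zero⟩
  have hne : χ.primitiveCharacter ≠ 1 := by
    intro h
    apply h1
    rw [← χ.changeLevel_primitiveCharacter, h, DirichletCharacter.changeLevel_one]
  have := meanSquareBound_coprime χ.primitiveCharacter_isPrimitive hne q (NeZero.ne q)
  refine MeanSquareBound.of_mul_period (p := χ.conductor) (NeZero.pos _) (periodic_dirichlet χ) ?_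
  rw [mul_comm]
  convert this using 2 with y
  split_ifs with hy
  · exact (χ.primitiveCharacter_apply_of_isCoprime hy).symm
  · rwa [DirichletCharacter.apply_eq_zero_iff]

/-! ### Smoothing at scales growing by a factor five -/

/-- The sum of `f` over the window of `2 * h + 1` consecutive integers centred at `x`. -/
noncomputable def windowSum (f : ℤ → ℂ) (h : ℕ) (x : ℤ) : ℂ :=
  ∑ y ∈ Ico (x - h) (x - h + (2 * h + 1 : ℕ)), f y

theorem windowSum_eq_sum_range (f : ℤ → ℂ) (h : ℕ) (x : ℤ) :
    windowSum f h x = ∑ r ∈ range (2 * h + 1), f (x + (r - h)) := by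
  rw [windowSum, sum_Ico_eq_sum_range_int]
  exact sum_congr rfl fun r _ ↦ by ring_nf

/-- A window five times as long splits into five adjacent windows. -/
theorem windowSum_five_mul_add_two (f : ℤ → ℂ) (h : ℕ) (x : ℤ) :
    windowSum f (5 * h + 2) x
      = ∑ i ∈ range 5, windowSum f h (x + (2 * h + 1 : ℕ) * ((i : ℤ) - 2)) := by
  have key := sum_Ico_mul_eq_sum_blocks (fun y ↦ f (y + (x - (5 * h + 2 : ℕ)))) (2 * h + 1) 5
  have hl := sum_Ico_shift f 0 (x - (5 * h + 2 : ℕ)) ((2 * h + 1) * 5)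
  rw [zero_add] at hl
  rw [hl] at key
  rw [windowSum, show 2 * (5 * h + 2) + 1 = (2 * h + 1) * 5 by ring]
  refine (by rw [zero_add] : _ = _).trans (key.trans (sum_congr rfl fun i _ ↦ ?_))
  rw [windowSum]
  have := sum_Ico_shift f 0
    (x + (2 * h + 1 : ℕ) * ((i : ℤ) - 2) - h) (2 * h + 1)
  rw [zero_add, zero_add] at this
  rw [← this]
  refine sum_congr rfl fun y _ ↦ ?_
  congr 1
  push_cast
  ring

/-- The Cauchy-Schwarz inequality against the constant function. -/
theorem norm_sum_Ico_sq_le (w : ℤ → ℂ) (a : ℤ) (n : ℕ) :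
    ‖∑ m ∈ Ico a (a + n), w m‖ ^ 2 ≤ n * ∑ m ∈ Ico a (a + n), ‖w m‖ ^ 2 := by
  have h1 : ‖∑ m ∈ Ico a (a + n), w m‖ ^ 2 ≤ (∑ m ∈ Ico a (a + n), ‖w m‖) ^ 2 := by
    gcongr
    exact norm_sum_le _ _
  refine h1.trans ?_
  have := sq_sum_le_card_mul_sum_sq (s := Ico a (a + (n : ℤ))) (f := fun m ↦ ‖w m‖)
  simpa using this

theorem sum_translate_sub (w : ℤ → ℂ) (a : ℤ) (N c : ℕ) :
    ∑ m ∈ Ico (a + c) (a + c + N), w m - ∑ m ∈ Ico a (a + N), w m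
      = ∑ m ∈ Ico (a + N) (a + N + c), w m - ∑ m ∈ Ico a (a + c), w m := by
  have h1 := sum_Ico_add_sum_Ico w (a := a) (b := a + c) (c := a + c + N) (by omega) (by omega)
  have h2 := sum_Ico_add_sum_Ico w (a := a) (b := a + N) (c := a + c + N) (by omega) (by omega)
  rw [show a + N + (c : ℤ) = a + c + N by ring]
  linear_combination h1 - h2

/-- The sum over `[a, a + N)`, compared with the sums over its translates by `-2H, …, 2H`: the
difference lives on four blocks of length `H` around each endpoint, with weights `±1, ±2`. -/
theorem sum_five_translates_sub (w : ℤ → ℂ) (a : ℤ) (N H : ℕ) :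
    ∑ i ∈ range 5, ∑ m ∈ Ico (a + H * ((i : ℤ) - 2)) (a + H * ((i : ℤ) - 2) + N), w m
        - 5 * ∑ m ∈ Ico a (a + N), w m
      = ∑ m ∈ Ico (a - 2 * H) (a - 2 * H + H), w m + 2 * ∑ m ∈ Ico (a - H) (a - H + H), w m
        - 2 * ∑ m ∈ Ico a (a + H), w m - ∑ m ∈ Ico (a + H) (a + H + H), w m
        - ∑ m ∈ Ico (a + N - 2 * H) (a + N - 2 * H + H), w m
        - 2 * ∑ m ∈ Ico (a + N - H) (a + N - H + H), w m
        + 2 * ∑ m ∈ Ico (a + N) (a + N + H), w m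
        + ∑ m ∈ Ico (a + N + H) (a + N + H + H), w m := by
  have t1 := sum_translate_sub w (a - 2 * H) N H
  have t2 := sum_translate_sub w (a - H) N H
  have t3 := sum_translate_sub w a N H
  have t4 := sum_translate_sub w (a + H) N H
  have e0 : a + H * (((0 : ℕ) : ℤ) - 2) = a - 2 * H := by push_cast; ring
  have e1 : a + H * (((1 : ℕ) : ℤ) - 2) = a - H := by push_cast; ring
  have e2 : a + H * (((2 : ℕ) : ℤ) - 2) = a := by push_cast; ring
  have e3 : a + H * (((3 : ℕ) : ℤ) - 2) = a + H := by push_cast; ring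
  have e4 : a + H * (((4 : ℕ) : ℤ) - 2) = a + H + H := by push_cast; ring
  simp only [sum_range_succ, range_zero, sum_empty, e0, e1, e2, e3, e4]
  rw [show a - 2 * (H : ℤ) + H = a - H by ring, show a - 2 * (H : ℤ) + N = a + N - 2 * H by ring,
    show a - (H : ℤ) + N = a + N - H by ring] at t1
  rw [show a - (H : ℤ) + H = a by ring, show a - (H : ℤ) + N = a + N - H by ring] at t2
  rw [show a + (H : ℤ) + N = a + N + H by ring] at t3 t4
  rw [show a - 2 * (H : ℤ) + H = a - H by ring, show a - 2 * (H : ℤ) + N = a + N - 2 * H by ring,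
    show a - (H : ℤ) + H = a by ring, show a - (H : ℤ) + N = a + N - H by ring,
    show a + (H : ℤ) + N = a + N + H by ring]
  linear_combination -2 * t2 - t1 + 2 * t3 + t4

/-- The conditions on the lengths make the eight blocks disjoint and fit into one period, so that the
Cauchy-Schwarz inequality costs only `20 = 2 (1 + 4 + 4 + 1)`, the sum of the squared weights. -/
theorem norm_five_translates_sub_sq_le (w : ℤ → ℂ) (a : ℤ) {N H q : ℕ} (hHN : 4 * H ≤ N)
    (hNq : 2 * N ≤ q) :
    ‖∑ i ∈ range 5, ∑ m ∈ Ico (a + H * ((i : ℤ) - 2)) (a + H * ((i : ℤ) - 2) + N), w m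
        - 5 * ∑ m ∈ Ico a (a + N), w m‖ ^ 2
      ≤ 20 * H * ∑ m ∈ Ico (a - 2 * H) (a - 2 * H + q), ‖w m‖ ^ 2 := by
  rw [sum_five_translates_sub]
  set b : ℤ := a + N with hb
  set B : ℤ → ℂ := fun u ↦ ∑ m ∈ Ico u (u + H), w m with hB
  set E : ℤ → ℝ := fun u ↦ ∑ m ∈ Ico u (u + H), ‖w m‖ ^ 2 with hE
  have hBE (u : ℤ) : ‖B u‖ ^ 2 ≤ H * E u := norm_sum_Ico_sq_le w u H
  have hEsum : E (a - 2 * H) + E (a - H) + E a + E (a + H) + E (b - 2 * H) + E (b - H) + E b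
      + E (b + H) ≤ ∑ m ∈ Ico (a - 2 * H) (a - 2 * H + q), ‖w m‖ ^ 2 := by
    have nn (u v : ℤ) : 0 ≤ ∑ m ∈ Ico u v, ‖w m‖ ^ 2 := sum_nonneg fun _ _ ↦ by positivity
    have split {u v x : ℤ} (huv : u ≤ v) (hvx : v ≤ x) :=
      sum_Ico_add_sum_Ico (fun m ↦ ‖w m‖ ^ 2) huv hvx
    have s1 := split (u := a - 2 * H) (v := a - H) (x := a - 2 * H + q) (by omega) (by omega)
    have s2 := split (u := a - H) (v := a) (x := a - 2 * H + q) (by omega) (by omega)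
    have s3 := split (u := a) (v := a + H) (x := a - 2 * H + q) (by omega) (by omega)
    have s4 := split (u := a + H) (v := a + H + H) (x := a - 2 * H + q) (by omega) (by omega)
    have s5 := split (u := a + H + H) (v := b - 2 * H) (x := a - 2 * H + q) (by omega) (by omega)
    have s6 := split (u := b - 2 * H) (v := b - H) (x := a - 2 * H + q) (by omega) (by omega)
    have s7 := split (u := b - H) (v := b) (x := a - 2 * H + q) (by omega) (by omega)
    have s8 := split (u := b) (v := b + H) (x := a - 2 * H + q) (by omega) (by omega)
    have s9 := split (u := b + H) (v := b + H + H) (x := a - 2 * H + q) (by omega) (by omega)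
    have n1 := nn (a + H + H) (b - 2 * H)
    have n2 := nn (b + H + H) (a - 2 * H + q)
    simp only [hE]
    rw [show a - 2 * (H : ℤ) + H = a - H by ring, show a - (H : ℤ) + H = a by ring,
      show b - 2 * (H : ℤ) + H = b - H by ring, show b - (H : ℤ) + H = b by ring]
    linarith
  have htri : ‖B (a - 2 * H) + 2 * B (a - H) - 2 * B a - B (a + H) - B (b - 2 * H) - 2 * B (b - H)
        + 2 * B b + B (b + H)‖
      ≤ ‖B (a - 2 * H)‖ + 2 * ‖B (a - H)‖ + 2 * ‖B a‖ + ‖B (a + H)‖ + ‖B (b - 2 * H)‖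
        + 2 * ‖B (b - H)‖ + 2 * ‖B b‖ + ‖B (b + H)‖ := by
    have two (z : ℂ) : ‖2 * z‖ = 2 * ‖z‖ := by simp
    simp only [← two]
    refine (norm_add_le _ _).trans (add_le_add_left ?_ _)
    refine (norm_add_le _ _).trans (add_le_add_left ?_ _)
    refine (norm_sub_le _ _).trans (add_le_add_left ?_ _)
    refine (norm_sub_le _ _).trans (add_le_add_left ?_ _)
    refine (norm_sub_le _ _).trans (add_le_add_left ?_ _)
    refine (norm_sub_le _ _).trans (add_le_add_left ?_ _)
    exact norm_add_le _ _
  have hcs := Finset.sum_mul_sq_le_sq_mul_sq univ (![1, 2, 2, 1, 1, 2, 2, 1] : Fin 8 → ℝ)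
    ![‖B (a - 2 * H)‖, ‖B (a - H)‖, ‖B a‖, ‖B (a + H)‖, ‖B (b - 2 * H)‖, ‖B (b - H)‖, ‖B b‖,
      ‖B (b + H)‖]
  simp only [Fin.sum_univ_eight, Matrix.cons_val, one_mul] at hcs
  refine (pow_le_pow_left₀ (norm_nonneg _) htri 2).trans (hcs.trans ?_)
  have hH : (0 : ℝ) ≤ H := by positivity
  calc _ ≤ 20 * (H * (E (a - 2 * H) + E (a - H) + E a + E (a + H) + E (b - 2 * H) + E (b - H)
        + E b + E (b + H))) := by
        have h1 := hBE (a - 2 * H)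
        have h2 := hBE (a - H)
        have h3 := hBE a
        have h4 := hBE (a + H)
        have h5 := hBE (b - 2 * H)
        have h6 := hBE (b - H)
        have h7 := hBE b
        have h8 := hBE (b + H)
        linarith
    _ ≤ _ := by
        rw [← mul_assoc]
        gcongr

theorem sum_range_abs_sub (h : ℕ) :
    ∑ r ∈ range (2 * h + 1), |(r : ℤ) - h| = h * (h + 1) := by
  induction h with
  | zero => simp
  | succ h ih =>
    rw [show 2 * (h + 1) + 1 = (2 * h + 1 + 1) + 1 by ring, sum_range_succ, sum_range_succ']
    have e : ∑ r ∈ range (2 * h + 1), |((r + 1 : ℕ) : ℤ) - (h + 1 : ℕ)|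
        = ∑ r ∈ range (2 * h + 1), |(r : ℤ) - h| :=
      sum_congr rfl fun r _ ↦ by push_cast; ring_nf
    rw [e, ih]
    push_cast
    rw [abs_of_nonneg (by linarith : (0 : ℤ) ≤ 2 * h + 2 - (h + 1)),
      abs_of_nonpos (by linarith : (0 : ℤ) - (h + 1) ≤ 0)]
    ring

theorem norm_sum_Ico_le {f : ℤ → ℂ} (h1 : ∀ y, ‖f y‖ ≤ 1) (a : ℤ) (n : ℕ) :
    ‖∑ y ∈ Ico a (a + n), f y‖ ≤ n := by
  refine (norm_sum_le_of_le _ fun y _ ↦ h1 y).trans ?_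
  simp

theorem norm_sum_translate_sub_le {f : ℤ → ℂ} (h1 : ∀ y, ‖f y‖ ≤ 1) (a i : ℤ) (N : ℕ) :
    ‖∑ m ∈ Ico (a + i) (a + i + N), f m - ∑ m ∈ Ico a (a + N), f m‖ ≤ 2 * |i| := by
  have key (a : ℤ) (c : ℕ) :
      ‖∑ m ∈ Ico (a + c) (a + c + N), f m - ∑ m ∈ Ico a (a + N), f m‖ ≤ 2 * c := by
    rw [sum_translate_sub]
    refine (norm_sub_le _ _).trans ?_
    have := norm_sum_Ico_le h1 (a + N) c
    have := norm_sum_Ico_le h1 a c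
    linarith
  obtain ⟨c, rfl | rfl⟩ := i.eq_nat_or_neg
  · simpa using key a c
  · have := key (a + -c) c
    rw [neg_add_cancel_right] at this
    rw [norm_sub_rev]
    simpa using this

theorem norm_sum_windowSum_sub_le {f : ℤ → ℂ} (h1 : ∀ y, ‖f y‖ ≤ 1) (a : ℤ) (N h : ℕ) :
    ‖∑ m ∈ Ico a (a + N), windowSum f h m - (2 * h + 1 : ℕ) * ∑ m ∈ Ico a (a + N), f m‖
      ≤ 2 * (h * (h + 1)) := by
  have e : ∑ m ∈ Ico a (a + N), windowSum f h m - (2 * h + 1 : ℕ) * ∑ m ∈ Ico a (a + N), f m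
      = ∑ r ∈ range (2 * h + 1), (∑ m ∈ Ico (a + (r - h)) (a + (r - h) + N), f m
        - ∑ m ∈ Ico a (a + N), f m) := by
    simp_rw [windowSum_eq_sum_range]
    rw [sum_comm, sum_sub_distrib, sum_const, card_range, nsmul_eq_mul]
    congr 1
    exact sum_congr rfl fun r _ ↦ sum_Ico_shift f a (r - h) N
  rw [e]
  refine (norm_sum_le_of_le _ fun (r : ℕ) _ ↦
    norm_sum_translate_sub_le h1 a ((r : ℤ) - h) N).trans_eq ?_
  rw [← mul_sum]
  congr 1
  have := sum_range_abs_sub h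
  exact_mod_cast this

theorem MeanSquareBound.sum_windowSum_le {f : ℤ → ℂ} {q : ℕ} (hf : Function.Periodic f (q : ℤ))
    (h : MeanSquareBound f q) (u : ℤ) (l : ℕ) :
    ∑ x ∈ Ico u (u + q), ‖windowSum f l x‖ ^ 2 ≤ (q * (2 * l + 1) : ℝ) := by
  have := h.sum_shift_le hf (u + -l) (2 * l + 1)
  rw [← sum_Ico_shift] at this
  exact_mod_cast this

/-- The sum of `f` over `[a, a + N)` after `f` has been averaged over centred windows of length
`2 * h + 1`. -/
noncomputable def smoothedSum (f : ℤ → ℂ) (a : ℤ) (N h : ℕ) : ℂ :=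
  (∑ m ∈ Ico a (a + N), windowSum f h m) / (2 * h + 1 : ℕ)

/-- Smoothing over a window of length `H` changes the sum by at most `H / 2`: a translate by `i` differs
from the original interval in at most `2 |i|` terms. -/
theorem norm_smoothedSum_sub_le {f : ℤ → ℂ} (h1 : ∀ y, ‖f y‖ ≤ 1) (a : ℤ) (N h : ℕ) :
    ‖smoothedSum f a N h - ∑ m ∈ Ico a (a + N), f m‖ ≤ (2 * h + 1) / 2 := by
  have hpos : (0 : ℝ) < (2 * h + 1 : ℕ) := by positivity
  have hne : ((2 * h + 1 : ℕ) : ℂ) ≠ 0 := by exact_mod_cast hpos.ne'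
  have := norm_sum_windowSum_sub_le h1 a N h
  rw [smoothedSum, div_sub' hne, norm_div, Complex.norm_natCast, div_le_iff₀ hpos]
  refine this.trans ?_
  push_cast
  nlinarith

/-- Each fivefold increase of the smoothing length costs at most `(2 / √5) √q`. -/
theorem norm_smoothedSum_five_sub_le {f : ℤ → ℂ} {q : ℕ} (hf : Function.Periodic f (q : ℤ))
    (hms : MeanSquareBound f q) (a : ℤ) {N h : ℕ} (hHN : 4 * (2 * h + 1) ≤ N) (hNq : 2 * N ≤ q) :
    ‖smoothedSum f a N (5 * h + 2) - smoothedSum f a N h‖ ≤ 2 / √5 * √q := by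
  have hpos : (0 : ℝ) < (2 * h + 1 : ℕ) := by positivity
  have hne : ((2 * h + 1 : ℕ) : ℂ) ≠ 0 := by exact_mod_cast hpos.ne'
  have e : smoothedSum f a N (5 * h + 2) - smoothedSum f a N h
      = (∑ i ∈ range 5, ∑ m ∈ Ico (a + (2 * h + 1 : ℕ) * ((i : ℤ) - 2))
          (a + (2 * h + 1 : ℕ) * ((i : ℤ) - 2) + N), windowSum f h m
        - 5 * ∑ m ∈ Ico a (a + N), windowSum f h m) / (5 * (2 * h + 1 : ℕ)) := by
    have : ∑ m ∈ Ico a (a + N), windowSum f (5 * h + 2) m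
        = ∑ i ∈ range 5, ∑ m ∈ Ico (a + (2 * h + 1 : ℕ) * ((i : ℤ) - 2))
          (a + (2 * h + 1 : ℕ) * ((i : ℤ) - 2) + N), windowSum f h m := by
      simp_rw [windowSum_five_mul_add_two]
      rw [sum_comm]
      exact sum_congr rfl fun i _ ↦ sum_Ico_shift (windowSum f h) a _ N
    rw [smoothedSum, smoothedSum, this, show 2 * (5 * h + 2) + 1 = 5 * (2 * h + 1) by ring,
      Nat.cast_mul, Nat.cast_ofNat, sub_div, mul_div_mul_left _ _ (by norm_num : (5 : ℂ) ≠ 0)]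
  have hsq := norm_five_translates_sub_sq_le (windowSum f h) a hHN hNq
  have hE := hms.sum_windowSum_le hf (a - 2 * (2 * h + 1 : ℕ)) h
  rw [e, norm_div, norm_mul, Complex.norm_natCast, Complex.norm_ofNat, div_le_iff₀ (by positivity)]
  refine abs_le_of_sq_le_sq' (hsq.trans ?_) (by positivity) |>.2
  calc _ ≤ 20 * (2 * h + 1 : ℕ) * (q * (2 * h + 1) : ℝ) := by gcongr
    _ = _ := by
      rw [mul_pow, mul_pow, div_pow, Real.sq_sqrt (by positivity), Real.sq_sqrt (by positivity)]
      push_cast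
      ring

/-- Smoothing over a window of length at least `N / 4` leaves at most `2 √q`. -/
theorem norm_smoothedSum_le {f : ℤ → ℂ} {q : ℕ} (hf : Function.Periodic f (q : ℤ))
    (hms : MeanSquareBound f q) (a : ℤ) {N h : ℕ} (hNH : N ≤ 4 * (2 * h + 1)) (hNq : N ≤ q) :
    ‖smoothedSum f a N h‖ ≤ 2 * √q := by
  have hpos : (0 : ℝ) < (2 * h + 1 : ℕ) := by positivity
  rw [smoothedSum, norm_div, Complex.norm_natCast, div_le_iff₀ hpos]
  refine abs_le_of_sq_le_sq' ?_ (by positivity) |>.2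
  have hE := hms.sum_windowSum_le hf a h
  have hsub : ∑ m ∈ Ico a (a + N), ‖windowSum f h m‖ ^ 2
      ≤ ∑ m ∈ Ico a (a + q), ‖windowSum f h m‖ ^ 2 :=
    sum_le_sum_of_subset_of_nonneg (Ico_subset_Ico_right (by omega)) fun _ _ _ ↦ by positivity
  have hN : (N : ℝ) ≤ 4 * (2 * h + 1) := by exact_mod_cast hNH
  calc _ ≤ _ := norm_sum_Ico_sq_le _ a N
    _ ≤ (4 * (2 * h + 1)) * (q * (2 * h + 1) : ℝ) := by
      gcongr
      exact hsub.trans hE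
    _ = _ := by
      rw [mul_pow, mul_pow, Real.sq_sqrt (by positivity)]
      push_cast
      ring

/-- The comparison after `L` fivefold increases of the window length `2 * h + 1`. -/
theorem exists_smoothedSum {f : ℤ → ℂ} {q : ℕ} (hf : Function.Periodic f (q : ℤ))
    (h1 : ∀ y, ‖f y‖ ≤ 1) (hms : MeanSquareBound f q) (a : ℤ) {N h : ℕ} (hNq : 2 * N ≤ q) (L : ℕ)
    (hL : ∀ j < L, 4 * (5 ^ j * (2 * h + 1)) ≤ N) :
    ∃ l, 2 * l + 1 = 5 ^ L * (2 * h + 1) ∧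
      ‖smoothedSum f a N l - ∑ m ∈ Ico a (a + N), f m‖
        ≤ (2 * h + 1) / 2 + L * (2 / √5 * √q) := by
  induction L with
  | zero => exact ⟨h, by simp, by simpa using norm_smoothedSum_sub_le h1 a N h⟩
  | succ L ih =>
    obtain ⟨l, hl, hle⟩ := ih fun j hj ↦ hL j (by omega)
    refine ⟨5 * l + 2, by rw [pow_succ]; linarith, ?_⟩
    have hstep := norm_smoothedSum_five_sub_le hf hms a (h := l) (hl ▸ hL L (by omega)) hNq
    have := norm_add_le (smoothedSum f a N (5 * l + 2) - smoothedSum f a N l)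
      (smoothedSum f a N l - ∑ m ∈ Ico a (a + N), f m)
    rw [sub_add_sub_cancel] at this
    push_cast
    linarith

/-- From `2 ^ 65 < 5 ^ 28`. -/
theorem log_five_gt : (1.6 : ℝ) < Real.log 5 := by
  have h : Real.log ((2 : ℝ) ^ 65) < Real.log (5 ^ 28) :=
    Real.log_lt_log (by norm_num) (by norm_num)
  rw [Real.log_pow, Real.log_pow] at h
  have := Real.log_two_gt_d9
  push_cast at h
  linarith

/-- Intervals of at most half a period: start from a window of length about `√q` and increase it
fivefold until it reaches `N / 4`. This takes at most `log q / (2 log 5)` steps, which gives the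
leading constant `1 / (√5 log 5) < 0.28`. -/
theorem norm_sum_le_of_two_mul_le {f : ℤ → ℂ} {q : ℕ} (hq : 729 ≤ q)
    (hf : Function.Periodic f (q : ℤ)) (h1 : ∀ y, ‖f y‖ ≤ 1) (hms : MeanSquareBound f q) (a : ℤ)
    {N : ℕ} (hNq : 2 * N ≤ q) :
    ‖∑ m ∈ Ico a (a + N), f m‖ ≤ 0.28 * √q * Real.log q + 2.52 * √q := by
  set s : ℝ := √q with hs
  have hsq : s ^ 2 = q := Real.sq_sqrt (by positivity)
  have hq' : (729 : ℝ) ≤ q := by exact_mod_cast hq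
  have hs27 : 27 ≤ s := by
    rw [hs, show (27 : ℝ) = √(27 ^ 2) by simp]
    exact Real.sqrt_le_sqrt (by linarith)
  -- The first window has length `2 * h + 1` between `√q - 1` and `√q + 1`.
  set h : ℕ := ⌊s / 2⌋₊ with hh
  have hh1 : (h : ℝ) ≤ s / 2 := Nat.floor_le (by positivity)
  have hh2 : s / 2 < h + 1 := Nat.lt_floor_add_one _
  have hex : ∃ L : ℕ, N ≤ 4 * (5 ^ L * (2 * h + 1)) := by
    refine ⟨N, (Nat.lt_pow_self (by norm_num : 1 < 5)).le.trans ?_⟩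
    nlinarith [Nat.zero_le (5 ^ N * h), Nat.zero_le (5 ^ N)]
  classical
  set L := Nat.find hex with hLdef
  have hLN : N ≤ 4 * (5 ^ L * (2 * h + 1)) := Nat.find_spec hex
  have hLmin (j : ℕ) (hj : j < L) : 4 * (5 ^ j * (2 * h + 1)) ≤ N :=
    (not_le.1 (Nat.find_min hex hj)).le
  obtain ⟨l, hl, hle⟩ := exists_smoothedSum hf h1 hms a hNq L hLmin
  have hend := norm_smoothedSum_le hf hms a (N := N) (h := l) (hl ▸ hLN) (by omega)
  -- Minimality of `L` gives `4 * 5 ^ (L - 1) * (2 * h + 1) ≤ N ≤ q / 2`.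
  have hpow : (5 : ℝ) ^ L ≤ s := by
    rcases Nat.eq_zero_or_pos L with h0 | hpos
    · rw [h0, pow_zero]; linarith
    · have hm := hLmin (L - 1) (by omega)
      have h5 : 5 ^ L = 5 * 5 ^ (L - 1) := by
        rw [← pow_succ', Nat.sub_add_cancel hpos]
      have hm' : 8 * (5 ^ L * (2 * h + 1)) ≤ 5 * q := by rw [h5]; nlinarith
      have hm'' : 8 * ((5 : ℝ) ^ L * (2 * h + 1)) ≤ 5 * s ^ 2 := by
        rw [hsq]; exact_mod_cast hm'
      have h5pos : (0 : ℝ) < 5 ^ L := by positivity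
      by_contra! hlt
      nlinarith
  have hLlog : L * Real.log 5 ≤ Real.log q / 2 := by
    have hlog2 : Real.log q = 2 * Real.log s := by
      rw [← hsq, Real.log_pow, Nat.cast_ofNat]
    rw [← Real.log_pow, hlog2]
    have := Real.log_le_log (by positivity) hpow
    linarith
  have hcoef : L * (2 / √5 * s) ≤ 0.28 * s * Real.log q := by
    have hL : L * 1.6 ≤ Real.log q / 2 :=
      (mul_le_mul_of_nonneg_left log_five_gt.le (by positivity)).trans hLlog
    have h5 : 2 / √5 ≤ 0.895 := by
      rw [div_le_iff₀ (by positivity)]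
      have : (2.236 : ℝ) ≤ √5 := Real.le_sqrt_of_sq_le (by norm_num)
      linarith
    have hL0 : (0 : ℝ) ≤ L := by positivity
    calc L * (2 / √5 * s) ≤ L * (0.895 * s) := by gcongr
      _ = s * (0.895 * L) := by ring
      _ ≤ s * (0.28 * Real.log q) :=
        mul_le_mul_of_nonneg_left (by linarith) (by linarith)
      _ = _ := by ring
  have htri := norm_sub_le (smoothedSum f a N l)
    (smoothedSum f a N l - ∑ m ∈ Ico a (a + N), f m)
  rw [sub_sub_cancel] at htri
  linarith

/-- The bound for all intervals: whole periods contribute nothing, and an interval longer than half a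
period is replaced by its complement in a period. -/
theorem norm_sum_le {f : ℤ → ℂ} {q : ℕ} (hq : 729 ≤ q)
    (hf : Function.Periodic f (q : ℤ)) (h1 : ∀ y, ‖f y‖ ≤ 1)
    (h0 : ∑ x ∈ Ico (0 : ℤ) q, f x = 0) (hms : MeanSquareBound f q) (a : ℤ) (N : ℕ) :
    ‖∑ m ∈ Ico a (a + N), f m‖ ≤ 0.28 * √q * Real.log q + 2.52 * √q := by
  rw [sum_Ico_add_of_sum_period_eq_zero hf h0]
  have hlt := Nat.mod_lt N (by omega : 0 < q)
  set n := N % q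
  rcases le_or_gt (2 * n) q with hn | hn
  · exact norm_sum_le_of_two_mul_le hq hf h1 hms a hn
  · have hper := sum_Ico_period hf a
    rw [h0, ← sum_Ico_add_sum_Ico f (a := a) (b := a + n) (by omega) (by omega)] at hper
    rw [eq_neg_of_add_eq_zero_left hper, norm_neg,
      show a + (q : ℤ) = a + n + (q - n : ℕ) by omega]
    exact norm_sum_le_of_two_mul_le hq hf h1 hms _ (by omega)

/-! ### The constants of the theorem -/

/-- The sequence `(k - 3 / 4) q` satisfies the recursion of `4 p` with equality, so the bound
propagates from its first two cases. -/
theorem four_mul_pShift_ge (k : ℕ) :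
    ((k + 2 : ℕ) - 3 / 4 : ℝ) * qShift (k + 2) ≤ 4 * pShift (k + 2) := by
  induction k using Nat.twoStepInduction with
  | zero => norm_num [qShift, pShift]
  | one => norm_num [qShift, pShift]
  | more k ih1 ih2 =>
    have hp : (2 * pShift (k + 4) : ℝ)
        = 2 * (2 * pShift (k + 3) + pShift (k + 2)) + (qShift (k + 3) + qShift (k + 2)) := by
      exact_mod_cast two_mul_pShift (k + 2)
    have hq : (qShift (k + 4) : ℝ) = 2 * qShift (k + 3) + qShift (k + 2) := by
      exact_mod_cast (rfl : qShift (k + 4) = _)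
    push_cast at ih1 ih2 ⊢
    rw [show k + 2 + 2 = k + 4 by rfl, hq]
    rw [show k + 1 + 2 = k + 3 by rfl] at ih2
    linarith

/-- The ratio `17 / 7` is slightly above the growth rate `1 + √2` of the sequence. -/
theorem qShift_le (k : ℕ) : (qShift (k + 2) : ℝ) ≤ 3 * (17 / 7) ^ k := by
  induction k using Nat.twoStepInduction with
  | zero => norm_num [qShift]
  | one => norm_num [qShift]
  | more k ih1 ih2 =>
    have hq : (qShift (k + 4) : ℝ) = 2 * qShift (k + 3) + qShift (k + 2) := by
      exact_mod_cast (rfl : qShift (k + 4) = _)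
    rw [show k + 2 + 2 = k + 4 by rfl, hq]
    have : (0 : ℝ) < (17 / 7) ^ k := by positivity
    rw [pow_succ] at ih2 ⊢
    rw [pow_succ]
    rw [show k + 1 + 2 = k + 3 by rfl] at ih2
    linarith

theorem three_le_qSeq (n : ℕ) : 3 ≤ qSeq n := by
  have hpos : ∀ k, 1 ≤ qShift k := fun k ↦ (qShift_odd k).pos
  have h1 := hpos (n + 1)
  have h2 := hpos n
  have : qSeq n = 2 * qShift (n + 1) + qShift n := rfl
  omega

/-- From `3 ^ 29 < 2 ^ 46`. -/
theorem log_three_lt : Real.log 3 < 1.1 := by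
  have h : Real.log ((3 : ℝ) ^ 29) < Real.log (2 ^ 46) :=
    Real.log_lt_log (by norm_num) (by norm_num)
  rw [Real.log_pow, Real.log_pow] at h
  have := Real.log_two_lt_d9
  push_cast at h
  linarith

/-- From `(17 / 7) ^ 32 < 2 ^ 41`. -/
theorem log_seventeen_div_seven_lt : Real.log (17 / 7) < 0.89 := by
  have h : Real.log ((17 / 7 : ℝ) ^ 32) < Real.log (2 ^ 41) :=
    Real.log_lt_log (by norm_num) (by norm_num)
  rw [Real.log_pow, Real.log_pow] at h
  have := Real.log_two_lt_d9
  push_cast at h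
  linarith

/-- The `δ_n` tend to `1 / (4 log (1 + √2)) = 0.2836…`, and stay above the leading constant of
`norm_sum_le`. -/
theorem delta_ge (n : ℕ) : 0.28 ≤ delta n := by
  have hq3 : (3 : ℝ) ≤ qSeq n := by exact_mod_cast three_le_qSeq n
  have hlogpos : 0 < Real.log (qSeq n) := Real.log_pos (by linarith)
  have hlog : Real.log (qSeq n) ≤ 1.1 + n * 0.89 := by
    have hle : (qSeq n : ℝ) ≤ 3 * (17 / 7) ^ n := qShift_le n
    have := Real.log_le_log (by linarith) hle
    rw [Real.log_mul (by norm_num) (by positivity), Real.log_pow] at this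
    have := log_three_lt
    have := mul_le_mul_of_nonneg_left log_seventeen_div_seven_lt.le (Nat.cast_nonneg (α := ℝ) n)
    linarith
  have hp : ((n + 2 : ℕ) - 3 / 4 : ℝ) * qSeq n ≤ 4 * pSeq n := four_mul_pShift_ge n
  rw [delta, le_div_iff₀ (by positivity)]
  push_cast at hp
  have hn : (0 : ℝ) ≤ n := by positivity
  nlinarith [mul_le_mul_of_nonneg_left hlog (by linarith : (0 : ℝ) ≤ qSeq n)]

theorem qSeq_sub_one_le (n : ℕ) : qSeq n ≤ 2 * pSeq n + 1 := by
  rcases n with _ | n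
  · decide
  · have hp : (((n + 1) + 2 : ℕ) - 3 / 4 : ℝ) * qSeq (n + 1) ≤ 4 * pSeq (n + 1) :=
      four_mul_pShift_ge (n + 1)
    push_cast at hp
    have hn : (0 : ℝ) ≤ n := by positivity
    have : (qSeq (n + 1) : ℝ) ≤ 2 * pSeq (n + 1) + 1 := by nlinarith
    exact_mod_cast this

theorem constant_ge (n : ℕ) :
    2.52 ≤ √((qSeq n : ℝ) + 1 / (qSeq n : ℝ) ^ 2)
      + (√2 - 1) * (2 * (pSeq n : ℝ) / ((qSeq n : ℝ) - 1)) + 1 / 2 := by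
  have hq3 : (3 : ℝ) ≤ qSeq n := by exact_mod_cast three_le_qSeq n
  have h1 : (1.7 : ℝ) ≤ √((qSeq n : ℝ) + 1 / (qSeq n : ℝ) ^ 2) := by
    refine Real.le_sqrt_of_sq_le ?_
    have : (0 : ℝ) < 1 / (qSeq n : ℝ) ^ 2 := by positivity
    linarith
  have h2 : (1.41 : ℝ) ≤ √2 := Real.le_sqrt_of_sq_le (by norm_num)
  have h3 : (1 : ℝ) ≤ 2 * (pSeq n : ℝ) / ((qSeq n : ℝ) - 1) := by
    rw [one_le_div (by linarith)]
    have : (qSeq n : ℝ) ≤ 2 * pSeq n + 1 := by exact_mod_cast qSeq_sub_one_le n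
    linarith
  nlinarith

theorem psi_nonneg (n q : ℕ) : 0 ≤ psi n q 1 := by
  have hq3 : (3 : ℝ) ≤ qSeq n := by exact_mod_cast three_le_qSeq n
  have h2 : (1 : ℝ) ≤ √2 := Real.le_sqrt_of_sq_le (by norm_num)
  have hd : 0 ≤ delta n := le_trans (by norm_num) (delta_ge n)
  have hl : 0 ≤ Real.log q := Real.log_natCast_nonneg q
  have h3 : (0 : ℝ) ≤ 2 * (pSeq n : ℝ) / ((qSeq n : ℝ) - 1) :=
    div_nonneg (by positivity) (by linarith)
  have h4 : 0 ≤ √2 - 1 := by linarith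
  unfold psi
  positivity

end PolyaVinogradov

theorem corollary1 (n q : ℕ) (hq : PolyaVinogradov.qSeq n ^ 6 ≤ q)
    (χ : DirichletCharacter ℂ q) (hχ : χ ≠ 1) (a : ℤ) (N : ℕ) :
    ‖∑ m ∈ Finset.Ioc a (a + (N : ℤ)), χ (m : ZMod q)‖
      ≤ PolyaVinogradov.delta n * √(q : ℝ) * Real.log (q : ℝ)
        + (√((PolyaVinogradov.qSeq n : ℝ) + 1 / (PolyaVinogradov.qSeq n : ℝ) ^ 2)
            + (√2 - 1) * (2 * (PolyaVinogradov.pSeq n : ℝ) / ((PolyaVinogradov.qSeq n : ℝ) - 1))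
            + 1 / 2) * √(q : ℝ)
        + PolyaVinogradov.psi n q 1 := by
  have hq729 : 729 ≤ q :=
    le_trans (by norm_num) ((Nat.pow_le_pow_left (PolyaVinogradov.three_le_qSeq n) 6).trans hq)
  have : NeZero q := ⟨by omega⟩
  have hIoc : Finset.Ioc a (a + (N : ℤ)) = Finset.Ico (a + 1) (a + 1 + N) := by
    ext x; simp only [Finset.mem_Ioc, Finset.mem_Ico]; omega
  rw [hIoc]
  have hmain := PolyaVinogradov.norm_sum_le hq729 (PolyaVinogradov.periodic_dirichlet χ)
    (fun y ↦ DirichletCharacter.norm_le_one χ _) (PolyaVinogradov.sum_dirichlet_period hχ)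
    (PolyaVinogradov.meanSquareBound_dirichletCharacter hχ) (a + 1) N
  have hlog : 0 ≤ Real.log (q : ℝ) := Real.log_natCast_nonneg q
  have h1 : 0.28 * √(q : ℝ) * Real.log q ≤ PolyaVinogradov.delta n * √(q : ℝ) * Real.log q := by
    gcongr
    exact PolyaVinogradov.delta_ge n
  have h2 := mul_le_mul_of_nonneg_right (PolyaVinogradov.constant_ge n) (Real.sqrt_nonneg (q : ℝ))
  have h3 := PolyaVinogradov.psi_nonneg n q
  linarith
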